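/- Let $\gamma_{\mathrm{TF}}>0$ and $Z\ge 0$ be real numbers. Let $\mathcal I$ be the set of all (almost-everywhere classes of) real functions $\rho\in L^{5/3}(\mathbb R^3)$ with $\rho\ge 0$ almost everywhere and $$D[\rho]:=\frac12\int_{\mathbb R^3}\int_{\mathbb R^3}\frac{\rho(x)\rho(y)}{|x-y|}\,dx\,dy<\infty ,$$ and, for real $N\ge 0$, let $\mathcal I_N:=\{\rho\in\mathcal I : \int_{\mathbb R^3}\rho\le N\}$. The atomic Thomas--Fermi functional of nuclear charge $Z$ is $$\mathcal E_Z^{\mathrm{TF}}(\rho):=\int_{\mathbb R^3}\Bigl(\tfrac35\gamma_{\mathrm{TF}}\,\rho(x)^{5/3}-\frac{Z}{|x|}\rho(x)\Bigr)dx+D[\rho].$$ Theorem. For every $\rho\in\mathcal I$ the integrand of the first term is integrable, so that $\mathcal E_Z^{\mathrm{TF}}$ is a well-defined real-valued functional on $\mathcal I$. There is exactly one minimizer of $\mathcal E_Z^{\mathrm{TF}}$ on $\mathcal I$, and for every real $N\ge 0$ there is exactly one minimizer of $\mathcal E_Z^{\mathrm{TF}}$ on $\mathcal I_N$. -/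

import Mathlib

open MeasureTheory
open scoped ENNReal

noncomputable section

namespace ThomasFermi

/-- Three-dimensional Euclidean space. -/
abbrev R3 : Type := EuclideanSpace ℝ (Fin 3)

/-- The real Lebesgue space of exponent `5/3` on Euclidean three-space; its elements are
classes of functions that agree almost everywhere. -/
abbrev L53 : Type := Lp ℝ (5 / 3 : ℝ≥0∞) (volume : Measure R3)

/-- The integrand `ρ(x) ρ(y) / |x - y|` of the Coulomb energy. -/
def coulombIntegrand (ρ : R3 → ℝ) (p : R3 × R3) : ℝ :=
  ρ p.1 * ρ p.2 / ‖p.1 - p.2‖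

/-- The Coulomb energy `D[ρ] = (1/2) ∫∫ ρ(x) ρ(y) / |x - y| dx dy`. -/
def coulombEnergy (ρ : R3 → ℝ) : ℝ :=
  (1 / 2) * ∫ p : R3 × R3, coulombIntegrand ρ p

/-- The one-body energy density `(3/5) γ ρ(x)^(5/3) - (Z / |x|) ρ(x)`. -/
def oneBodyDensity (γ Z : ℝ) (ρ : R3 → ℝ) (x : R3) : ℝ :=
  3 / 5 * γ * ρ x ^ (5 / 3 : ℝ) - Z / ‖x‖ * ρ x

/-- The atomic Thomas-Fermi functional with Thomas-Fermi constant `γ` and nuclear charge `Z`. -/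
def energy (γ Z : ℝ) (ρ : L53) : ℝ :=
  (∫ x : R3, oneBodyDensity γ Z ρ x) + coulombEnergy ρ

/-- The set of nonnegative densities in `L^(5/3)` of finite Coulomb energy. For `ρ ≥ 0`,
integrability of the (nonnegative) Coulomb integrand says exactly that `D[ρ] < ∞`. -/
def densities : Set L53 :=
  {ρ | (∀ᵐ x : R3, 0 ≤ ρ x) ∧ Integrable (coulombIntegrand ρ)}

/-- The densities of total mass at most `N`. -/
def densitiesLE (N : ℝ) : Set L53 :=
  {ρ | ρ ∈ densities ∧ Integrable (ρ : R3 → ℝ) ∧ ∫ x : R3, ρ x ≤ N}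

/-- `ρ` minimizes the real-valued functional `F` on the set `S`. -/
def IsMinimizer (F : L53 → ℝ) (S : Set L53) (ρ : L53) : Prop :=
  ρ ∈ S ∧ ∀ τ ∈ S, F ρ ≤ F τ

end ThomasFermi

end

/-!
The proof is by uniform convexity, so no weak compactness is needed.

* The Coulomb kernel is a superposition of products of Gaussians,
  `c / |x - y| = ∫∫ φ_{t,z}(x) φ_{t,z}(y) dz dt`, so that the Coulomb energy of a nonnegative
  density is an integral of squares of linear functionals and hence convex
  (`coulombLIntegral_add_le`). The attraction by the nucleus is linear, and the power
  `‖ρ‖ ^ (5/3)` is uniformly convex on nonnegative functions (`exists_norm_sub_rpow_le`): the norm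
  of `ρ - τ` is controlled by the midpoint defect.
* The attraction `∫ ρ / |x|` is split at a radius `R`. Inside, `1 / |x|` belongs to `L^(5/2)`, and
  Hölder's inequality applies. Outside, with `m(r)` the mass in the ball of radius `r`, the
  attraction is at most `∫_R^∞ m(r) / r² dr`, and `∫_0^∞ m(r)² / r² dr` is bounded by the Coulomb
  energy, because `1 / max (|x|, |y|) ≤ 2 / |x - y|` (`lintegral_compl_ball_le`). The outer part is
  therefore small for large `R`, uniformly on sets of bounded Coulomb energy. This gives the
  integrability of the one-body density and the coercivity of the energy
  (`exists_le_energy_add`).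
* Two densities of almost minimal energy in a midpoint-convex set are close in `L^(5/3)`, since
  their midpoint cannot have energy below the infimum (`exists_norm_sub_lt_of_energy_le`). So
  minimizers are unique and minimizing sequences converge strongly. Along a minimizing sequence the
  power term and the attraction converge, and the Coulomb energy and the mass are lower
  semicontinuous by Fatou's lemma; the limit is a minimizer (`existsUnique_isMinimizer`).
-/

namespace ThomasFermi

/-! ### The Coulomb kernel as a superposition of squares -/

/-- A kernel of the form `K(x, y) = ∫ φ(ω, x) φ(ω, y) dω` turns the double integral of
`f(x) f(y) K(x, y)` into an integral of squares. -/
theorem lintegral_lintegral_mul_superposition {α Ω : Type*} [MeasurableSpace α]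
    [MeasurableSpace Ω] {ν : Measure α} [SFinite ν] {μ : Measure Ω} [SFinite μ]
    {φ : Ω → α → ℝ≥0∞} (hφ : Measurable (Function.uncurry φ)) {f : α → ℝ≥0∞}
    (hf : Measurable f) :
    ∫⁻ x, ∫⁻ y, f x * f y * ∫⁻ ω, φ ω x * φ ω y ∂μ ∂ν ∂ν
      = ∫⁻ ω, (∫⁻ x, f x * φ ω x ∂ν) ^ 2 ∂μ := by
  have hφx : ∀ x, Measurable fun ω => φ ω x := fun x => hφ.of_uncurry_right
  have hφω : ∀ ω, Measurable (φ ω) := fun ω => hφ.of_uncurry_left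
  have hpair : Measurable fun p : α × Ω => f p.1 * φ p.2 p.1 :=
    (hf.comp measurable_fst).mul (hφ.comp measurable_swap)
  have hM : Measurable fun ω => ∫⁻ y, f y * φ ω y ∂ν := by
    exact Measurable.lintegral_prod_right' (f := fun p : Ω × α => f p.2 * φ p.1 p.2)
      ((hf.comp measurable_snd).mul hφ)
  have inner : ∀ x, ∫⁻ y, f x * f y * ∫⁻ ω, φ ω x * φ ω y ∂μ ∂ν
      = ∫⁻ ω, f x * φ ω x * ∫⁻ y, f y * φ ω y ∂ν ∂μ := by
    intro x
    calc ∫⁻ y, f x * f y * ∫⁻ ω, φ ω x * φ ω y ∂μ ∂ν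
        = ∫⁻ y, ∫⁻ ω, (f x * φ ω x) * (f y * φ ω y) ∂μ ∂ν := by
          refine lintegral_congr fun y => ?_
          rw [← lintegral_const_mul _ ((hφx x).fun_mul (hφx y))]
          refine lintegral_congr fun ω => ?_
          ring
      _ = ∫⁻ ω, ∫⁻ y, (f x * φ ω x) * (f y * φ ω y) ∂ν ∂μ := by
          refine lintegral_lintegral_swap (Measurable.aemeasurable ?_)
          exact (((hφx x).comp measurable_snd).const_mul _).mul hpair
      _ = _ := by
          refine lintegral_congr fun ω => ?_
          rw [lintegral_const_mul _ (hf.fun_mul (hφω ω))]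
  simp_rw [inner]
  rw [lintegral_lintegral_swap]
  · refine lintegral_congr fun ω => ?_
    rw [lintegral_mul_const _ (hf.fun_mul (hφω ω)), sq]
  · exact (hpair.mul (hM.comp measurable_snd)).aemeasurable

/-- The double integral of `f(x) f(y) / |x - y|`, with values in `[0, ∞]`. The kernel is infinite on
the diagonal, which is a null set. -/
noncomputable def coulombLIntegral (f : R3 → ℝ≥0∞) : ℝ≥0∞ :=
  ∫⁻ x, ∫⁻ y, f x * f y * ‖x - y‖ₑ⁻¹

theorem coulombLIntegral_congr {f g : R3 → ℝ≥0∞} (h : f =ᵐ[volume] g) :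
    coulombLIntegral f = coulombLIntegral g := by
  refine lintegral_congr_ae ?_
  filter_upwards [h] with x hx
  refine lintegral_congr_ae ?_
  filter_upwards [h] with y hy
  rw [hx, hy]

theorem coulombLIntegral_const_mul {c : ℝ≥0∞} (hc : c ≠ ∞) (f : R3 → ℝ≥0∞) :
    coulombLIntegral (fun x => c * f x) = c ^ 2 * coulombLIntegral f := by
  unfold coulombLIntegral
  rw [← lintegral_const_mul' _ _ (by finiteness)]
  refine lintegral_congr fun x => ?_
  rw [← lintegral_const_mul' _ _ (by finiteness)]
  refine lintegral_congr fun y => ?_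
  ring

/-- The Gaussians whose superposition is the Coulomb kernel: the parameter is an inverse
variance `t` and a centre `z`. -/
noncomputable def coulombGaussian (ω : ℝ × R3) (x : R3) : ℝ≥0∞ :=
  ENNReal.ofReal (√ω.1 * Real.exp (-2 * ω.1 * ‖x - ω.2‖ ^ 2))

theorem measurable_coulombGaussian : Measurable (Function.uncurry coulombGaussian) := by
  unfold coulombGaussian Function.uncurry
  fun_prop

/-- The parallelogram identity `|x - z|² + |y - z|² = 2 |z - (x + y) / 2|² + |x - y|² / 2` reduces
the product of two Gaussians with the same variance to a single one. -/
theorem lintegral_coulombGaussian_center {t : ℝ} (ht : 0 < t) (x y : R3) :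
    ∫⁻ z, coulombGaussian (t, z) x * coulombGaussian (t, z) y
      = ENNReal.ofReal ((Real.pi / 4) ^ (3 / 2 : ℝ) *
          (t ^ ((1 / 2 : ℝ) - 1) * Real.exp (-(‖x - y‖ ^ 2 * t)))) := by
  set m : R3 := (1 / 2 : ℝ) • (x + y) with hm
  have key : ∀ z : R3, ‖x - z‖ ^ 2 + ‖y - z‖ ^ 2 = 2 * ‖z - m‖ ^ 2 + ‖x - y‖ ^ 2 / 2 := by
    intro z
    have h := parallelogram_law_with_norm ℝ (x - z) (y - z)
    have h1 : x - z + (y - z) = (-2 : ℝ) • (z - m) := by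
      rw [hm]; module
    have h2 : x - z - (y - z) = x - y := by abel
    rw [h1, h2, norm_smul] at h
    norm_num at h
    nlinarith
  have hpt : ∀ z : R3, coulombGaussian (t, z) x * coulombGaussian (t, z) y
      = ENNReal.ofReal (t * Real.exp (-(‖x - y‖ ^ 2 * t)) *
          Real.exp (-(4 * t) * ‖z - m‖ ^ 2)) := by
    intro z
    unfold coulombGaussian
    rw [← ENNReal.ofReal_mul (by positivity)]
    congr 1
    have : -2 * t * ‖x - z‖ ^ 2 + -2 * t * ‖y - z‖ ^ 2
        = -(‖x - y‖ ^ 2 * t) + -(4 * t) * ‖z - m‖ ^ 2 := by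
      have := key z
      linear_combination (-2 * t) * this
    calc √t * Real.exp (-2 * t * ‖x - z‖ ^ 2) * (√t * Real.exp (-2 * t * ‖y - z‖ ^ 2))
        = (√t * √t) * Real.exp (-2 * t * ‖x - z‖ ^ 2 + -2 * t * ‖y - z‖ ^ 2) := by
          rw [Real.exp_add]; ring
      _ = _ := by rw [Real.mul_self_sqrt ht.le, this, Real.exp_add]; ring
  simp_rw [hpt]
  have hg := GaussianFourier.integral_rexp_neg_mul_sq_norm (V := R3) (b := 4 * t) (by positivity)
  have hgi : Integrable fun v : R3 => Real.exp (-(4 * t) * ‖v‖ ^ 2) := by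
    refine Integrable.of_integral_ne_zero ?_
    rw [hg]
    have := Real.pi_pos
    positivity
  rw [lintegral_sub_right_eq_self (fun z : R3 => ENNReal.ofReal
    (t * Real.exp (-(‖x - y‖ ^ 2 * t)) * Real.exp (-(4 * t) * ‖z‖ ^ 2))) m,
    ← ofReal_integral_eq_lintegral_ofReal (hgi.const_mul _)
      (Filter.Eventually.of_forall fun z => by positivity), integral_const_mul, hg]
  congr 1
  have h3 : ((Module.finrank ℝ R3 : ℕ) : ℝ) = 3 := by simp
  rw [h3, ← div_div, Real.div_rpow (by positivity) ht.le]
  have h4 : t ^ ((1 / 2 : ℝ) - 1) = t / t ^ (3 / 2 : ℝ) := by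
    rw [eq_div_iff (by positivity), ← Real.rpow_add ht]
    norm_num
  rw [h4]
  ring

/-- Off the diagonal the Coulomb kernel is a superposition of products of Gaussians with positive
weights; the constant is `(π / 4) ^ (3 / 2) * Γ(1 / 2)`. -/
theorem exists_lintegral_coulombGaussian_eq :
    ∃ c : ℝ≥0∞, c ≠ 0 ∧ c ≠ ∞ ∧ ∀ x y : R3, x ≠ y →
      ∫⁻ ω, coulombGaussian ω x * coulombGaussian ω y
        ∂((volume.restrict (Set.Ioi (0 : ℝ))).prod volume) = c * ‖x - y‖ₑ⁻¹ := by
  have hpos : 0 < (Real.pi / 4) ^ (3 / 2 : ℝ) * Real.Gamma (1 / 2) := by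
    have := Real.pi_pos
    have := Real.Gamma_pos_of_pos (s := 1 / 2) (by norm_num)
    positivity
  refine ⟨ENNReal.ofReal ((Real.pi / 4) ^ (3 / 2 : ℝ) * Real.Gamma (1 / 2)), by simpa using hpos,
    by finiteness, fun x y hxy => ?_⟩
  have hd : 0 < ‖x - y‖ := norm_pos_iff.2 (sub_ne_zero.2 hxy)
  rw [lintegral_prod]
  swap
  · exact ((measurable_coulombGaussian.of_uncurry_right).mul
      (measurable_coulombGaussian.of_uncurry_right)).aemeasurable
  rw [setLIntegral_congr_fun measurableSet_Ioi
    (fun t ht => lintegral_coulombGaussian_center ht x y)]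
  have hI := Real.integral_rpow_mul_exp_neg_mul_Ioi (a := 1 / 2) (r := ‖x - y‖ ^ 2)
    (by norm_num) (by positivity)
  have hΓ := Real.Gamma_pos_of_pos (s := 1 / 2) (by norm_num)
  have hint : IntegrableOn (fun t : ℝ => t ^ ((1 / 2 : ℝ) - 1) * Real.exp (-(‖x - y‖ ^ 2 * t)))
      (Set.Ioi 0) := by
    refine Integrable.of_integral_ne_zero ?_
    rw [hI]
    positivity
  rw [← ofReal_integral_eq_lintegral_ofReal (hint.const_mul _), integral_const_mul, hI,
    ← ofReal_norm, ← ENNReal.ofReal_inv_of_pos hd, ← ENNReal.ofReal_mul hpos.le]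
  · congr 1
    have : (1 / ‖x - y‖ ^ 2) ^ (1 / 2 : ℝ) = ‖x - y‖⁻¹ := by
      rw [← Real.sqrt_eq_rpow, ← one_div_pow, Real.sqrt_sq (by positivity), one_div]
    rw [this]
    ring
  · filter_upwards [ae_restrict_mem measurableSet_Ioi] with t ht
    have : 0 < t := ht
    have := Real.pi_pos
    positivity

/-- Positive definiteness of the Coulomb kernel: the Coulomb integral is an integral of squares. -/
theorem exists_mul_coulombLIntegral_eq :
    ∃ c : ℝ≥0∞, c ≠ 0 ∧ c ≠ ∞ ∧ ∀ f : R3 → ℝ≥0∞, Measurable f →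
      c * coulombLIntegral f = ∫⁻ ω, (∫⁻ x, f x * coulombGaussian ω x) ^ 2
        ∂((volume.restrict (Set.Ioi (0 : ℝ))).prod volume) := by
  obtain ⟨c, hc0, hc, h⟩ := exists_lintegral_coulombGaussian_eq
  refine ⟨c, hc0, hc, fun f hf => ?_⟩
  rw [← lintegral_lintegral_mul_superposition measurable_coulombGaussian hf, coulombLIntegral,
    ← lintegral_const_mul' _ _ hc]
  refine lintegral_congr fun x => ?_
  rw [← lintegral_const_mul' _ _ hc]
  refine lintegral_congr_ae ?_
  filter_upwards [compl_mem_ae_iff.2 (measure_singleton x)] with y hy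
  rw [h x y (fun e => hy e.symm)]
  ring

theorem _root_.ENNReal.add_sq_le_two_mul (a b : ℝ≥0∞) : (a + b) ^ 2 ≤ 2 * a ^ 2 + 2 * b ^ 2 := by
  have h := ENNReal.rpow_add_le_mul_rpow_add_rpow a b (p := 2) (by norm_num)
  norm_num at h
  rwa [mul_add] at h

/-- Convexity of the Coulomb energy, in the form of one half of the parallelogram law. -/
theorem coulombLIntegral_add_le {f g : R3 → ℝ≥0∞} (hf : Measurable f) (hg : Measurable g) :
    coulombLIntegral (fun x => f x + g x) ≤ 2 * coulombLIntegral f + 2 * coulombLIntegral g := by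
  obtain ⟨c, hc0, hc, h⟩ := exists_mul_coulombLIntegral_eq
  rw [← ENNReal.mul_le_mul_iff_right hc0 hc, h _ (hf.fun_add hg), mul_add, mul_left_comm, h f hf,
    mul_left_comm, h g hg]
  have hm : ∀ f : R3 → ℝ≥0∞, Measurable f →
      Measurable fun ω => (∫⁻ x, f x * coulombGaussian ω x) ^ 2 := fun f hf =>
    (Measurable.lintegral_prod_right'
      (f := fun p : (ℝ × R3) × R3 => f p.2 * coulombGaussian p.1 p.2)
      ((hf.comp measurable_snd).mul measurable_coulombGaussian)).pow_const 2
  rw [← lintegral_const_mul _ (hm f hf), ← lintegral_const_mul _ (hm g hg),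
    ← lintegral_add_left ((hm f hf).const_mul _)]
  refine lintegral_mono fun ω => ?_
  have : ∫⁻ x, (f x + g x) * coulombGaussian ω x
      = (∫⁻ x, f x * coulombGaussian ω x) + ∫⁻ x, g x * coulombGaussian ω x := by
    rw [← lintegral_add_left (hf.fun_mul measurable_coulombGaussian.of_uncurry_left)]
    simp_rw [add_mul]
  simp only [this]
  exact ENNReal.add_sq_le_two_mul _ _

/-! ### The Coulomb potential of the nucleus -/

theorem lintegral_Ioi_ofReal_inv_sq {a : ℝ} (ha : 0 < a) :
    ∫⁻ r in Set.Ioi a, ENNReal.ofReal r⁻¹ ^ 2 = (ENNReal.ofReal a)⁻¹ := by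
  have h1 : ∀ r ∈ Set.Ioi a, ENNReal.ofReal r⁻¹ ^ 2 = ENNReal.ofReal (r ^ (-2 : ℝ)) := by
    intro r hr
    have hr0 : 0 < r := ha.trans hr
    rw [← ENNReal.ofReal_pow (by positivity), Real.rpow_neg hr0.le, Real.rpow_two, inv_pow]
  rw [setLIntegral_congr_fun measurableSet_Ioi h1, ← ofReal_integral_eq_lintegral_ofReal
    (integrableOn_Ioi_rpow_of_lt (by norm_num) ha), integral_Ioi_rpow_of_lt (by norm_num) ha,
    ← ENNReal.ofReal_inv_of_pos ha]
  · congr 1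
    norm_num [Real.rpow_neg_one]
  · filter_upwards [ae_restrict_mem measurableSet_Ioi] with r hr
    have : 0 < r := ha.trans hr
    positivity

theorem ofReal_two_mul (a : ℝ) : ENNReal.ofReal (2 * a) = 2 * ENNReal.ofReal a := by
  rw [ENNReal.ofReal_mul (by norm_num), ENNReal.ofReal_ofNat]

/-- The indicator function of the centred open ball of radius `r`, divided by `r`. -/
noncomputable def scaledBall (r : ℝ) (x : R3) : ℝ≥0∞ :=
  {p : ℝ × R3 | ‖p.2‖ < p.1}.indicator (fun p => ENNReal.ofReal p.1⁻¹) (r, x)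

theorem measurable_scaledBall : Measurable (Function.uncurry scaledBall) :=
  Measurable.indicator (by fun_prop) (measurableSet_lt (by fun_prop) (by fun_prop))

theorem scaledBall_mul_scaledBall (r : ℝ) (x y : R3) :
    scaledBall r x * scaledBall r y
      = (Set.Ioi (max ‖x‖ ‖y‖)).indicator (fun r => ENNReal.ofReal r⁻¹ ^ 2) r := by
  unfold scaledBall
  by_cases hx : ‖x‖ < r <;> by_cases hy : ‖y‖ < r <;>
    simp [Set.indicator, hx, hy, sq]

theorem lintegral_scaledBall_mul {x y : R3} (h : 0 < max ‖x‖ ‖y‖) :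
    ∫⁻ r in Set.Ioi (0 : ℝ), scaledBall r x * scaledBall r y
      = (ENNReal.ofReal (max ‖x‖ ‖y‖))⁻¹ := by
  simp_rw [scaledBall_mul_scaledBall]
  rw [lintegral_indicator measurableSet_Ioi, Measure.restrict_restrict measurableSet_Ioi,
    Set.inter_eq_left.2 (Set.Ioi_subset_Ioi h.le), lintegral_Ioi_ofReal_inv_sq h]

/-- The bound `1 / max (|x|, |y|) ≤ 2 / |x - y|`, integrated against `f ⊗ f`. -/
theorem lintegral_scaledBall_sq_le {f : R3 → ℝ≥0∞} (hf : Measurable f) :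
    ∫⁻ r in Set.Ioi (0 : ℝ), (∫⁻ x, f x * scaledBall r x) ^ 2 ≤ 2 * coulombLIntegral f := by
  rw [← lintegral_lintegral_mul_superposition measurable_scaledBall hf, coulombLIntegral,
    ← lintegral_const_mul' _ _ (by finiteness)]
  refine lintegral_mono fun x => ?_
  rw [← lintegral_const_mul' _ _ (by finiteness)]
  refine lintegral_mono_ae ?_
  filter_upwards [compl_mem_ae_iff.2 (measure_singleton x)] with y hy
  have hd : 0 < ‖x - y‖ := norm_pos_iff.2 (sub_ne_zero.2 fun e => hy e.symm)
  have hle : ‖x - y‖ ≤ 2 * max ‖x‖ ‖y‖ := by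
    have := norm_sub_le x y
    have := le_max_left ‖x‖ ‖y‖
    have := le_max_right ‖x‖ ‖y‖
    linarith
  have hmax : 0 < max ‖x‖ ‖y‖ := by linarith
  rw [lintegral_scaledBall_mul hmax, mul_left_comm]
  refine mul_le_mul_right ?_ _
  rw [← ofReal_norm, ← ENNReal.ofReal_inv_of_pos hd, ← ENNReal.ofReal_inv_of_pos hmax,
    ← ofReal_two_mul]
  refine ENNReal.ofReal_le_ofReal ?_
  rw [← div_eq_mul_inv, inv_le_iff_one_le_mul₀ hmax, div_mul_eq_mul_div, one_le_div hd]
  exact hle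

/-- The Coulomb energy controls the attraction by the nucleus outside a ball. With
`m(r) = ∫_{|x| < r} f`, the left side is at most `∫_R^∞ m(r) / r² dr`, while
`∫_0^∞ m(r)² / r² dr = ∫∫ f(x) f(y) / max (|x|, |y|) dx dy` is at most twice the Coulomb
integral. -/
theorem lintegral_compl_ball_le {f : R3 → ℝ≥0∞} (hf : Measurable f) {R : ℝ} (hR : 0 < R)
    {ε : ℝ≥0∞} (hε0 : ε ≠ 0) (hε : ε ≠ ∞) :
    ∫⁻ x in (Metric.ball 0 R)ᶜ, f x * ‖x‖ₑ⁻¹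
      ≤ ε * (2 * coulombLIntegral f) + ε⁻¹ * (ENNReal.ofReal R)⁻¹ := by
  have hS' : ∀ r, Measurable (scaledBall r) := fun r => measurable_scaledBall.of_uncurry_left
  have hM : Measurable fun r => ∫⁻ x, f x * scaledBall r x :=
    Measurable.lintegral_prod_right' (f := fun p : ℝ × R3 => f p.2 * scaledBall p.1 p.2)
      ((hf.comp measurable_snd).mul measurable_scaledBall)
  have hinv : Measurable fun r : ℝ => ENNReal.ofReal r⁻¹ := by fun_prop
  calc ∫⁻ x in (Metric.ball 0 R)ᶜ, f x * ‖x‖ₑ⁻¹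
      ≤ ∫⁻ x in (Metric.ball 0 R)ᶜ, ∫⁻ r in Set.Ioi R,
          ENNReal.ofReal r⁻¹ * (f x * scaledBall r x) := by
        refine setLIntegral_mono' measurableSet_ball.compl fun x hx => ?_
        have hx' : R ≤ ‖x‖ := by simpa using hx
        have hx0 : 0 < ‖x‖ := hR.trans_le hx'
        have e1 : ∀ r, ENNReal.ofReal r⁻¹ * (f x * scaledBall r x)
            = f x * (Set.Ioi ‖x‖).indicator (fun r => ENNReal.ofReal r⁻¹ ^ 2) r := by
          intro r
          have h := scaledBall_mul_scaledBall r x x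
          rw [max_self] at h
          rw [← h]
          by_cases hr : ‖x‖ < r
          · simp [scaledBall, Set.indicator, hr]
            ring
          · simp [scaledBall, Set.indicator, hr]
        simp_rw [e1]
        rw [lintegral_const_mul _ ((hinv.pow_const 2).indicator measurableSet_Ioi),
          lintegral_indicator measurableSet_Ioi, Measure.restrict_restrict measurableSet_Ioi,
          Set.inter_eq_left.2 (Set.Ioi_subset_Ioi hx'), lintegral_Ioi_ofReal_inv_sq hx0,
          ofReal_norm]
    _ ≤ ∫⁻ x, ∫⁻ r in Set.Ioi R, ENNReal.ofReal r⁻¹ * (f x * scaledBall r x) :=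
        setLIntegral_le_lintegral _ _
    _ = ∫⁻ r in Set.Ioi R, ENNReal.ofReal r⁻¹ * ∫⁻ x, f x * scaledBall r x := by
        rw [lintegral_lintegral_swap]
        · refine lintegral_congr fun r => ?_
          rw [lintegral_const_mul _ (hf.fun_mul (hS' r))]
        · exact ((hinv.comp measurable_snd).mul ((hf.comp measurable_fst).mul
            (measurable_scaledBall.comp measurable_swap))).aemeasurable
    _ ≤ ∫⁻ r in Set.Ioi R, (ε * (∫⁻ x, f x * scaledBall r x) ^ 2
          + ε⁻¹ * ENNReal.ofReal r⁻¹ ^ 2) := by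
        refine lintegral_mono fun r => ?_
        -- For each `r`, compare the two factors: either `a ≤ ε b` or `ε b ≤ a`.
        generalize ENNReal.ofReal r⁻¹ = a
        generalize ∫⁻ x, f x * scaledBall r x = b
        rcases le_total a (ε * b) with h | h
        · calc a * b ≤ (ε * b) * b := by gcongr
            _ = ε * b ^ 2 := by ring
            _ ≤ _ := le_self_add
        · have hb : b ≤ ε⁻¹ * a := by
            rw [← ENNReal.div_eq_inv_mul, ENNReal.le_div_iff_mul_le (.inl hε0) (.inl hε), mul_comm]
            exact h
          calc a * b ≤ a * (ε⁻¹ * a) := by gcongr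
            _ = ε⁻¹ * a ^ 2 := by ring
            _ ≤ _ := le_add_self
    _ = ε * (∫⁻ r in Set.Ioi R, (∫⁻ x, f x * scaledBall r x) ^ 2)
          + ε⁻¹ * (ENNReal.ofReal R)⁻¹ := by
        rw [lintegral_add_left ((hM.pow_const 2).const_mul _),
          lintegral_const_mul _ (hM.pow_const 2),
          lintegral_const_mul _ (hinv.pow_const 2), lintegral_Ioi_ofReal_inv_sq hR]
    _ ≤ _ := by
        gcongr
        exact (lintegral_mono_set (Set.Ioi_subset_Ioi hR.le)).trans (lintegral_scaledBall_sq_le hf)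

theorem lintegral_ball_enorm_inv_rpow_lt_top (R : ℝ) :
    ∫⁻ x in Metric.ball (0 : R3) R, ‖x‖ₑ⁻¹ ^ (5 / 2 : ℝ) < ∞ := by
  have h := integrableOn_ball_of_norm_le_rpow (E := R3) (μ := volume) (r := R) (C := 1)
    (α := 5 / 2) (f := fun x => ‖x‖ ^ (-(5 / 2) : ℝ)) (by simp) (by norm_num)
    (Filter.Eventually.of_forall fun x => by
      rw [one_mul, Real.norm_of_nonneg (by positivity)])
    (measurable_norm.pow_const _).aestronglyMeasurable
  refine lt_of_eq_of_lt (lintegral_congr_ae ?_) h.hasFiniteIntegral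
  filter_upwards [compl_mem_ae_iff.2 (measure_singleton (0 : R3))] with x hx
  have hx0 : 0 < ‖x‖ := norm_pos_iff.2 hx
  rw [← ofReal_norm, ← ENNReal.ofReal_inv_of_pos hx0,
    ENNReal.ofReal_rpow_of_nonneg (by positivity) (by norm_num), ← ofReal_norm,
    Real.norm_of_nonneg (by positivity), Real.inv_rpow hx0.le, Real.rpow_neg hx0.le]

/-- Hölder's inequality against the potential `1 / |x|`, whose power `5/2` is locally
integrable. -/
theorem exists_lintegral_ball_le (R : ℝ) :
    ∃ C : ℝ≥0∞, C ≠ ∞ ∧ ∀ f : R3 → ℝ≥0∞, Measurable f →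
      ∫⁻ x in Metric.ball 0 R, f x * ‖x‖ₑ⁻¹
        ≤ C * (∫⁻ x, f x ^ (5 / 3 : ℝ)) ^ (3 / 5 : ℝ) := by
  refine ⟨(∫⁻ x in Metric.ball (0 : R3) R, ‖x‖ₑ⁻¹ ^ (5 / 2 : ℝ)) ^ (2 / 5 : ℝ),
    ENNReal.rpow_ne_top_of_nonneg (by norm_num) (lintegral_ball_enorm_inv_rpow_lt_top R).ne,
    fun f hf => ?_⟩
  have h := ENNReal.lintegral_mul_le_Lp_mul_Lq (volume.restrict (Metric.ball (0 : R3) R))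
    (p := 5 / 3) (q := 5 / 2) (by rw [Real.holderConjugate_iff]; norm_num)
    (f := f) (g := fun x => ‖x‖ₑ⁻¹) hf.aemeasurable (by fun_prop)
  refine h.trans ?_
  rw [mul_comm]
  norm_num only
  gcongr
  exact Measure.restrict_le_self

/-! ### Uniform convexity of the `5/3` power -/

/-- On `[0, 1]` the second derivative of `x ^ (5/3)` is at least `10/9`. -/
theorem convexOn_rpow_sub_sq :
    ConvexOn ℝ (Set.Icc 0 1) fun x : ℝ => x ^ (5 / 3 : ℝ) - 5 / 9 * x ^ 2 := by
  have hd : ∀ x : ℝ, HasDerivAt (fun x : ℝ => x ^ (5 / 3 : ℝ) - 5 / 9 * x ^ 2)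
      (5 / 3 * x ^ (2 / 3 : ℝ) - 10 / 9 * x) x := by
    intro x
    have h1 := Real.hasDerivAt_rpow_const (x := x) (p := 5 / 3) (.inr (by norm_num))
    have h2 := ((hasDerivAt_id x).pow 2).const_mul (5 / 9 : ℝ)
    refine (h1.sub h2).congr_deriv ?_
    norm_num
    ring
  have hderiv : deriv (fun x : ℝ => x ^ (5 / 3 : ℝ) - 5 / 9 * x ^ 2)
      = fun x => 5 / 3 * x ^ (2 / 3 : ℝ) - 10 / 9 * x := funext fun x => (hd x).deriv
  have hd2 : ∀ x ∈ Set.Ioo (0 : ℝ) 1, HasDerivAt (fun x : ℝ => 5 / 3 * x ^ (2 / 3 : ℝ) - 10 / 9 * x)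
      (10 / 9 * x ^ (-(1 / 3) : ℝ) - 10 / 9) x := by
    intro x hx
    have h1 := (Real.hasDerivAt_rpow_const (x := x) (p := 2 / 3) (.inl hx.1.ne')).const_mul
      (5 / 3 : ℝ)
    have h2 := (hasDerivAt_id x).const_mul (10 / 9 : ℝ)
    refine (h1.sub h2).congr_deriv ?_
    norm_num
    ring
  refine convexOn_of_deriv2_nonneg (convex_Icc 0 1)
    (fun x _ => (hd x).continuousAt.continuousWithinAt)
    (fun x _ => (hd x).differentiableAt.differentiableWithinAt) ?_ ?_
  · rw [hderiv, interior_Icc]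
    exact fun x hx => (hd2 x hx).differentiableAt.differentiableWithinAt
  · rw [interior_Icc]
    intro x hx
    rw [Function.iterate_succ, Function.iterate_one, Function.comp_apply, hderiv,
      (hd2 x hx).deriv]
    have := Real.one_le_rpow_of_pos_of_le_one_of_nonpos hx.1 hx.2.le
      (show (-(1 / 3) : ℝ) ≤ 0 by norm_num)
    linarith

/-- Pointwise uniform convexity. If `|a - b| ≤ δ max (a, b)` the first term on the right
dominates; otherwise the midpoint defect is at least a multiple of `max (a, b) ^ (5/3)`. -/
theorem exists_abs_sub_rpow_le {ε : ℝ} (hε : 0 < ε) :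
    ∃ C : ℝ, 0 ≤ C ∧ ∀ a b : ℝ, 0 ≤ a → 0 ≤ b →
      |a - b| ^ (5 / 3 : ℝ) ≤ ε * (a ^ (5 / 3 : ℝ) + b ^ (5 / 3 : ℝ))
        + C * (a ^ (5 / 3 : ℝ) / 2 + b ^ (5 / 3 : ℝ) / 2 - ((a + b) / 2) ^ (5 / 3 : ℝ)) := by
  set δ : ℝ := ε ^ (3 / 5 : ℝ) with hδ
  have hδ0 : 0 < δ := by positivity
  have hδε : δ ^ (5 / 3 : ℝ) = ε := by
    rw [hδ, ← Real.rpow_mul hε.le]; norm_num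
  have hC0 : (0 : ℝ) ≤ 36 / 5 * (δ ^ 2)⁻¹ := by positivity
  refine ⟨36 / 5 * (δ ^ 2)⁻¹, hC0, ?_⟩
  have hord : ∀ a b : ℝ, 0 ≤ b → b ≤ a →
      |a - b| ^ (5 / 3 : ℝ) ≤ ε * (a ^ (5 / 3 : ℝ) + b ^ (5 / 3 : ℝ))
        + 36 / 5 * (δ ^ 2)⁻¹ *
          (a ^ (5 / 3 : ℝ) / 2 + b ^ (5 / 3 : ℝ) / 2 - ((a + b) / 2) ^ (5 / 3 : ℝ)) := by
    intro a b hb hba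
    rcases (hb.trans hba).eq_or_lt with ha | ha
    · have : b = 0 := le_antisymm (ha ▸ hba) hb
      subst this
      subst ha
      simp
    obtain ⟨t, rfl⟩ : ∃ t, b = a * t := ⟨b / a, by field_simp⟩
    have ht0 : 0 ≤ t := nonneg_of_mul_nonneg_right hb ha
    have ht1 : t ≤ 1 := le_of_mul_le_mul_left (by simpa using hba) ha
    have hconv := convexOn_rpow_sub_sq.2 (Set.right_mem_Icc.2 zero_le_one) ⟨ht0, ht1⟩
      (show (0 : ℝ) ≤ 1 / 2 by norm_num) (show (0 : ℝ) ≤ 1 / 2 by norm_num) (by norm_num)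
    simp only [smul_eq_mul, Real.one_rpow] at hconv
    have hdef : 5 / 36 * (1 - t) ^ 2
        ≤ 1 / 2 + t ^ (5 / 3 : ℝ) / 2 - ((1 + t) / 2) ^ (5 / 3 : ℝ) := by
      rw [show (1 : ℝ) / 2 * 1 + 1 / 2 * t = (1 + t) / 2 by ring] at hconv
      nlinarith
    have htp : 0 ≤ t ^ (5 / 3 : ℝ) := by positivity
    have hone : (1 - t) ^ (5 / 3 : ℝ) ≤ ε * (1 + t ^ (5 / 3 : ℝ)) + 36 / 5 * (δ ^ 2)⁻¹ *
        (1 / 2 + t ^ (5 / 3 : ℝ) / 2 - ((1 + t) / 2) ^ (5 / 3 : ℝ)) := by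
      rcases le_total (1 - t) δ with h | h
      · have h1 : (1 - t) ^ (5 / 3 : ℝ) ≤ ε := by
          rw [← hδε]
          exact Real.rpow_le_rpow (by linarith) h (by norm_num)
        have h2 := mul_nonneg hC0 ((by positivity : 0 ≤ 5 / 36 * (1 - t) ^ 2).trans hdef)
        nlinarith [mul_nonneg hε.le htp]
      · have h1 : (1 - t) ^ (5 / 3 : ℝ) ≤ 1 :=
          Real.rpow_le_one (by linarith) (by linarith) (by norm_num)
        have h2 := mul_le_mul_of_nonneg_left hdef hC0
        have h3 : 1 ≤ (δ ^ 2)⁻¹ * (1 - t) ^ 2 := by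
          rw [← div_eq_inv_mul, one_le_div (by positivity)]
          gcongr
        have h4 : 0 ≤ ε * (1 + t ^ (5 / 3 : ℝ)) := by positivity
        linarith
    have e1 : |a - a * t| ^ (5 / 3 : ℝ) = a ^ (5 / 3 : ℝ) * (1 - t) ^ (5 / 3 : ℝ) := by
      rw [show a - a * t = a * (1 - t) by ring, abs_of_nonneg (mul_nonneg ha.le (by linarith)),
        Real.mul_rpow ha.le (by linarith)]
    have e2 : ((a + a * t) / 2) ^ (5 / 3 : ℝ) = a ^ (5 / 3 : ℝ) * ((1 + t) / 2) ^ (5 / 3 : ℝ) := by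
      rw [show (a + a * t) / 2 = a * ((1 + t) / 2) by ring, Real.mul_rpow ha.le (by linarith)]
    rw [e1, e2, Real.mul_rpow ha.le ht0]
    calc _ ≤ _ := mul_le_mul_of_nonneg_left hone (by positivity : 0 ≤ a ^ (5 / 3 : ℝ))
      _ = _ := by ring
  intro a b ha hb
  rcases le_total b a with h | h
  · exact hord a b hb h
  · have := hord b a ha h
    rw [abs_sub_comm, add_comm a b, add_comm (a ^ (5 / 3 : ℝ)), add_comm (a ^ (5 / 3 : ℝ) / 2)]
    exact this

instance fact_one_le_five_thirds : Fact ((1 : ℝ≥0∞) ≤ 5 / 3) :=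
  ⟨by rw [ENNReal.le_div_iff_mul_le (by simp) (by simp)]; norm_num⟩

section Lp

variable {α : Type*} [MeasurableSpace α] {μ : Measure α}

theorem integrable_abs_rpow (f : Lp ℝ (5 / 3 : ℝ≥0∞) μ) :
    Integrable (fun x => |f x| ^ (5 / 3 : ℝ)) μ := by
  simpa using (Lp.memLp f).integrable_norm_rpow (by simp) (by finiteness)

theorem norm_rpow_eq_integral (f : Lp ℝ (5 / 3 : ℝ≥0∞) μ) :
    ‖f‖ ^ (5 / 3 : ℝ) = ∫ x, |f x| ^ (5 / 3 : ℝ) ∂μ := by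
  have h0 : 0 ≤ ∫ x, |f x| ^ (5 / 3 : ℝ) ∂μ := integral_nonneg fun x => by positivity
  rw [Lp.norm_def, (Lp.memLp f).eLpNorm_eq_integral_rpow_norm (by simp) (by finiteness)]
  simp only [ENNReal.toReal_div, ENNReal.toReal_ofNat, Real.norm_eq_abs]
  rw [ENNReal.toReal_ofReal (by positivity), ← Real.rpow_mul h0]
  norm_num

theorem lintegral_enorm_rpow (f : Lp ℝ (5 / 3 : ℝ≥0∞) μ) :
    (∫⁻ x, ‖f x‖ₑ ^ (5 / 3 : ℝ) ∂μ) ^ (3 / 5 : ℝ) = ENNReal.ofReal ‖f‖ := by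
  rw [Lp.norm_def, ENNReal.ofReal_toReal (Lp.eLpNorm_ne_top f),
    eLpNorm_eq_lintegral_rpow_enorm_toReal (by simp) (by finiteness)]
  simp

/-- Uniform convexity of the `5/3` power of the norm on the nonnegative functions. -/
theorem exists_norm_sub_rpow_le {ε : ℝ} (hε : 0 < ε) :
    ∃ C : ℝ, 0 ≤ C ∧ ∀ f g : Lp ℝ (5 / 3 : ℝ≥0∞) μ, (∀ᵐ x ∂μ, 0 ≤ f x) → (∀ᵐ x ∂μ, 0 ≤ g x) →
      ‖f - g‖ ^ (5 / 3 : ℝ) ≤ ε * (‖f‖ ^ (5 / 3 : ℝ) + ‖g‖ ^ (5 / 3 : ℝ))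
        + C * (‖f‖ ^ (5 / 3 : ℝ) / 2 + ‖g‖ ^ (5 / 3 : ℝ) / 2
          - ‖(1 / 2 : ℝ) • (f + g)‖ ^ (5 / 3 : ℝ)) := by
  obtain ⟨C, hC0, hC⟩ := exists_abs_sub_rpow_le hε
  refine ⟨C, hC0, fun f g hf hg => ?_⟩
  simp only [norm_rpow_eq_integral]
  have hfi := integrable_abs_rpow f
  have hgi := integrable_abs_rpow g
  have hmi := integrable_abs_rpow ((1 / 2 : ℝ) • (f + g))
  have hsum : Integrable (fun x => ε * (|f x| ^ (5 / 3 : ℝ) + |g x| ^ (5 / 3 : ℝ))) μ :=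
    (hfi.add hgi).const_mul ε
  have hdefect : Integrable (fun x => C * (|f x| ^ (5 / 3 : ℝ) / 2 + |g x| ^ (5 / 3 : ℝ) / 2
      - |((1 / 2 : ℝ) • (f + g) : Lp ℝ (5 / 3 : ℝ≥0∞) μ) x| ^ (5 / 3 : ℝ))) μ :=
    (((hfi.div_const 2).add (hgi.div_const 2)).sub hmi).const_mul C
  rw [← integral_add hfi hgi, ← integral_const_mul, ← integral_div, ← integral_div,
    ← integral_add (hfi.div_const 2) (hgi.div_const 2),
    ← integral_sub ((hfi.div_const 2).fun_add (hgi.div_const 2)) hmi, ← integral_const_mul,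
    ← integral_add hsum hdefect]
  refine integral_mono_ae (integrable_abs_rpow (f - g)) (hsum.add hdefect) ?_
  filter_upwards [hf, hg, Lp.coeFn_sub f g, Lp.coeFn_smul (1 / 2 : ℝ) (f + g), Lp.coeFn_add f g]
    with x hfx hgx h1 h2 h3
  have hm : ((1 / 2 : ℝ) • (f + g) : Lp ℝ (5 / 3 : ℝ≥0∞) μ) x = (f x + g x) / 2 := by
    rw [h2, Pi.smul_apply, h3, Pi.add_apply, smul_eq_mul]
    ring
  simp only [h1, hm, Pi.sub_apply]
  rw [abs_of_nonneg hfx, abs_of_nonneg hgx, abs_of_nonneg (by linarith : 0 ≤ (f x + g x) / 2)]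
  exact hC _ _ hfx hgx

end Lp

/-! ### The parts of the energy functional -/

theorem measurable_enorm_coe (ρ : L53) : Measurable fun x => ‖ρ x‖ₑ :=
  (Lp.stronglyMeasurable ρ).measurable.enorm

theorem stronglyMeasurable_coulombIntegrand (ρ : L53) :
    StronglyMeasurable (coulombIntegrand ρ) := by
  have h := (Lp.stronglyMeasurable ρ).measurable
  refine Measurable.stronglyMeasurable ?_
  exact ((h.comp measurable_fst).mul (h.comp measurable_snd)).div (by fun_prop)

theorem lintegral_enorm_coulombIntegrand (ρ : L53) :
    ∫⁻ p, ‖coulombIntegrand ρ p‖ₑ = coulombLIntegral fun x => ‖ρ x‖ₑ := by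
  rw [Measure.volume_eq_prod, lintegral_prod _
    (stronglyMeasurable_coulombIntegrand ρ).measurable.enorm.aemeasurable]
  refine lintegral_congr fun x => lintegral_congr_ae ?_
  -- Off the diagonal the real quotient has the expected extended norm.
  filter_upwards [compl_mem_ae_iff.2 (measure_singleton x)] with y hy
  have hxy : ‖x - y‖ ≠ 0 := norm_ne_zero_iff.2 (sub_ne_zero.2 fun e => hy e.symm)
  simp only [coulombIntegrand, div_eq_mul_inv, enorm_mul, enorm_inv hxy, enorm_norm]

theorem integrable_coulombIntegrand_iff (ρ : L53) :
    Integrable (coulombIntegrand ρ) ↔ coulombLIntegral (fun x => ‖ρ x‖ₑ) ≠ ∞ := by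
  rw [← lintegral_enorm_coulombIntegrand, ← lt_top_iff_ne_top]
  exact ⟨fun h => h.2, fun h =>
    ⟨(stronglyMeasurable_coulombIntegrand ρ).aestronglyMeasurable, h⟩⟩

theorem ae_nonneg_coulombIntegrand {ρ : L53} (hρ : ∀ᵐ x : R3, 0 ≤ ρ x) :
    ∀ᵐ p : R3 × R3, 0 ≤ coulombIntegrand ρ p := by
  rw [Measure.volume_eq_prod]
  filter_upwards [Measure.quasiMeasurePreserving_fst.ae hρ,
    Measure.quasiMeasurePreserving_snd.ae hρ] with p h1 h2
  exact div_nonneg (mul_nonneg h1 h2) (norm_nonneg _)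

theorem coulombEnergy_nonneg {ρ : L53} (hρ : ρ ∈ densities) : 0 ≤ coulombEnergy ρ :=
  mul_nonneg (by norm_num) (integral_nonneg_of_ae (ae_nonneg_coulombIntegrand hρ.1))

theorem ofReal_two_mul_coulombEnergy {ρ : L53} (hρ : ρ ∈ densities) :
    ENNReal.ofReal (2 * coulombEnergy ρ) = coulombLIntegral fun x => ‖ρ x‖ₑ := by
  rw [coulombEnergy, ← mul_assoc, mul_one_div_cancel (by norm_num), one_mul,
    ← lintegral_enorm_coulombIntegrand,
    ofReal_integral_eq_lintegral_ofReal hρ.2 (ae_nonneg_coulombIntegrand hρ.1)]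
  refine lintegral_congr_ae ?_
  filter_upwards [ae_nonneg_coulombIntegrand hρ.1] with p hp
  rw [Real.enorm_of_nonneg hp]

theorem ae_midpoint_eq_and_nonneg {ρ τ : L53} (hρ : ∀ᵐ x : R3, 0 ≤ ρ x) (hτ : ∀ᵐ x : R3, 0 ≤ τ x) :
    ∀ᵐ x : R3, ((1 / 2 : ℝ) • (ρ + τ) : L53) x = (ρ x + τ x) / 2 ∧
      0 ≤ ((1 / 2 : ℝ) • (ρ + τ) : L53) x := by
  filter_upwards [hρ, hτ, Lp.coeFn_smul (1 / 2 : ℝ) (ρ + τ), Lp.coeFn_add ρ τ] with x h1 h2 h3 h4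
  have : ((1 / 2 : ℝ) • (ρ + τ) : L53) x = (ρ x + τ x) / 2 := by
    rw [h3, Pi.smul_apply, h4, Pi.add_apply, smul_eq_mul]
    ring
  exact ⟨this, by rw [this]; positivity⟩

theorem coulombLIntegral_midpoint_le {ρ τ : L53} (hρ : ∀ᵐ x : R3, 0 ≤ ρ x)
    (hτ : ∀ᵐ x : R3, 0 ≤ τ x) :
    2 * coulombLIntegral (fun x => ‖((1 / 2 : ℝ) • (ρ + τ) : L53) x‖ₑ)
      ≤ coulombLIntegral (fun x => ‖ρ x‖ₑ) + coulombLIntegral (fun x => ‖τ x‖ₑ) := by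
  have hsum : coulombLIntegral (fun x => ‖ρ x‖ₑ + ‖τ x‖ₑ)
      = 2 ^ 2 * coulombLIntegral (fun x => ‖((1 / 2 : ℝ) • (ρ + τ) : L53) x‖ₑ) := by
    rw [← coulombLIntegral_const_mul (by simp)]
    refine coulombLIntegral_congr ?_
    filter_upwards [hρ, hτ, ae_midpoint_eq_and_nonneg hρ hτ] with x h1 h2 h3
    rw [h3.1, Real.enorm_of_nonneg h1, Real.enorm_of_nonneg h2,
      Real.enorm_of_nonneg (by positivity),
      ← ENNReal.ofReal_add h1 h2, ← ofReal_two_mul]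
    congr 1
    ring
  have h := coulombLIntegral_add_le (measurable_enorm_coe ρ) (measurable_enorm_coe τ)
  rw [hsum, sq, mul_assoc, ← mul_add] at h
  exact (ENNReal.mul_le_mul_iff_right (by simp) (by simp)).1 h

theorem midpoint_mem_densities {ρ τ : L53} (hρ : ρ ∈ densities) (hτ : τ ∈ densities) :
    (1 / 2 : ℝ) • (ρ + τ) ∈ densities := by
  refine ⟨(ae_midpoint_eq_and_nonneg hρ.1 hτ.1).mono fun x hx => hx.2, ?_⟩
  rw [integrable_coulombIntegrand_iff]
  have h := coulombLIntegral_midpoint_le hρ.1 hτ.1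
  have h1 := (integrable_coulombIntegrand_iff ρ).1 hρ.2
  have h2 := (integrable_coulombIntegrand_iff τ).1 hτ.2
  intro htop
  rw [htop, ENNReal.mul_top (by simp), top_le_iff] at h
  exact ENNReal.add_ne_top.2 ⟨h1, h2⟩ h

theorem coulombEnergy_midpoint_le {ρ τ : L53} (hρ : ρ ∈ densities) (hτ : τ ∈ densities) :
    coulombEnergy ((1 / 2 : ℝ) • (ρ + τ) : L53) ≤ (coulombEnergy ρ + coulombEnergy τ) / 2 := by
  have h := coulombLIntegral_midpoint_le hρ.1 hτ.1
  have hρ0 := coulombEnergy_nonneg hρ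
  have hτ0 := coulombEnergy_nonneg hτ
  rw [← ofReal_two_mul_coulombEnergy hρ, ← ofReal_two_mul_coulombEnergy hτ,
    ← ofReal_two_mul_coulombEnergy (midpoint_mem_densities hρ hτ), ← ofReal_two_mul,
    ← ENNReal.ofReal_add (by positivity) (by positivity),
    ENNReal.ofReal_le_ofReal_iff (by positivity)] at h
  linarith

/-- The attraction `∫ ρ(x) / |x| dx` of the density `ρ` by a unit charge at the origin. -/
noncomputable def nuclearAttraction (ρ : L53) : ℝ :=
  ∫ x : R3, ρ x / ‖x‖

theorem lintegral_enorm_div_norm (ρ : L53) :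
    ∫⁻ x : R3, ‖ρ x / ‖x‖‖ₑ = ∫⁻ x : R3, ‖ρ x‖ₑ * ‖x‖ₑ⁻¹ := by
  refine lintegral_congr_ae ?_
  filter_upwards [compl_mem_ae_iff.2 (measure_singleton (0 : R3))] with x hx
  rw [div_eq_mul_inv, enorm_mul, enorm_inv (norm_ne_zero_iff.2 hx), enorm_norm]

/-- The attraction by the nucleus, split at radius `R` into a part that is Lipschitz in `L^(5/3)`
and a tail controlled by the Coulomb integral. -/
theorem exists_lintegral_mul_inv_le {ε R : ℝ} (hε : 0 < ε) (hR : 0 < R) :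
    ∃ C : ℝ, 0 ≤ C ∧ ∀ ρ τ : L53, ∫⁻ x : R3, ‖ρ x‖ₑ * ‖x‖ₑ⁻¹
      ≤ (∫⁻ x : R3, ‖τ x‖ₑ * ‖x‖ₑ⁻¹) + ENNReal.ofReal (C * ‖ρ - τ‖)
        + (ENNReal.ofReal ε * (2 * coulombLIntegral fun x => ‖ρ x‖ₑ)
          + ENNReal.ofReal (ε⁻¹ * R⁻¹)) := by
  obtain ⟨C, hC, h⟩ := exists_lintegral_ball_le R
  refine ⟨C.toReal, ENNReal.toReal_nonneg, fun ρ τ => ?_⟩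
  have hball := h _ (measurable_enorm_coe (ρ - τ))
  rw [lintegral_enorm_rpow] at hball
  have hcompl := lintegral_compl_ball_le (measurable_enorm_coe ρ) hR
    (ε := ENNReal.ofReal ε) (by simpa using hε) (by finiteness)
  rw [← lintegral_add_compl _ (measurableSet_ball (x := (0 : R3)) (ε := R)),
    ENNReal.ofReal_mul ENNReal.toReal_nonneg, ENNReal.ofReal_toReal hC,
    ENNReal.ofReal_mul (by positivity), ENNReal.ofReal_inv_of_pos hε, ENNReal.ofReal_inv_of_pos hR]
  refine add_le_add ?_ hcompl
  refine le_trans ?_ (add_le_add (setLIntegral_le_lintegral (Metric.ball 0 R) _) hball)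
  rw [← lintegral_add_left ((measurable_enorm_coe τ).fun_mul (by fun_prop))]
  refine lintegral_mono_ae (ae_restrict_of_ae ?_)
  filter_upwards [Lp.coeFn_sub ρ τ] with x hx
  rw [← add_mul, hx, Pi.sub_apply]
  gcongr
  calc ‖ρ x‖ₑ = ‖τ x + (ρ x - τ x)‖ₑ := by rw [add_sub_cancel]
    _ ≤ _ := enorm_add_le _ _

theorem lintegral_mul_inv_ne_top {ρ : L53} (hρ : Integrable (coulombIntegrand ρ)) :
    ∫⁻ x : R3, ‖ρ x‖ₑ * ‖x‖ₑ⁻¹ ≠ ∞ := by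
  obtain ⟨C, -, h⟩ := exists_lintegral_mul_inv_le one_pos one_pos
  refine ne_top_of_le_ne_top ?_ (h ρ 0)
  have hzero : ∫⁻ x : R3, ‖(0 : L53) x‖ₑ * ‖x‖ₑ⁻¹ = 0 := by simp
  rw [hzero]
  have := (integrable_coulombIntegrand_iff ρ).1 hρ
  finiteness

theorem integrable_div_norm {ρ : L53} (hρ : Integrable (coulombIntegrand ρ)) :
    Integrable fun x : R3 => ρ x / ‖x‖ := by
  refine ⟨((Lp.stronglyMeasurable ρ).measurable.div (by fun_prop)).aestronglyMeasurable, ?_⟩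
  rw [hasFiniteIntegral_iff_enorm, lintegral_enorm_div_norm]
  exact (lintegral_mul_inv_ne_top hρ).lt_top

theorem ofReal_nuclearAttraction {ρ : L53} (hρ : ρ ∈ densities) :
    ENNReal.ofReal (nuclearAttraction ρ) = ∫⁻ x : R3, ‖ρ x‖ₑ * ‖x‖ₑ⁻¹ := by
  have h0 : ∀ᵐ x : R3, 0 ≤ ρ x / ‖x‖ := hρ.1.mono fun x hx => div_nonneg hx (norm_nonneg x)
  rw [nuclearAttraction, ofReal_integral_eq_lintegral_ofReal (integrable_div_norm hρ.2) h0,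
    ← lintegral_enorm_div_norm]
  refine lintegral_congr_ae ?_
  filter_upwards [h0] with x hx
  rw [Real.enorm_of_nonneg hx]

theorem nuclearAttraction_nonneg {ρ : L53} (hρ : ρ ∈ densities) : 0 ≤ nuclearAttraction ρ :=
  integral_nonneg_of_ae (hρ.1.mono fun x hx => div_nonneg hx (norm_nonneg x))

/-- Near the nucleus the attraction is Lipschitz in `L^(5/3)`; far away it is controlled by the
Coulomb energy. -/
theorem exists_nuclearAttraction_le {ε R : ℝ} (hε : 0 < ε) (hR : 0 < R) :
    ∃ C : ℝ, 0 ≤ C ∧ ∀ ρ ∈ densities, ∀ τ ∈ densities,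
      nuclearAttraction ρ ≤ nuclearAttraction τ + C * ‖ρ - τ‖
        + (4 * ε * coulombEnergy ρ + ε⁻¹ * R⁻¹) := by
  obtain ⟨C, hC, h⟩ := exists_lintegral_mul_inv_le hε hR
  refine ⟨C, hC, fun ρ hρ τ hτ => ?_⟩
  have h := h ρ τ
  have hD := coulombEnergy_nonneg hρ
  have hA := nuclearAttraction_nonneg hτ
  rw [← ofReal_nuclearAttraction hρ, ← ofReal_nuclearAttraction hτ,
    ← ofReal_two_mul_coulombEnergy hρ, ← ofReal_two_mul,
    ← ENNReal.ofReal_mul (by positivity),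
    ← ENNReal.ofReal_add (by positivity) (by positivity),
    ← ENNReal.ofReal_add (by positivity) (by positivity),
    ← ENNReal.ofReal_add (by positivity) (by positivity),
    ENNReal.ofReal_le_ofReal_iff (by positivity)] at h
  linarith

theorem nuclearAttraction_midpoint {ρ τ : L53} (hρ : ρ ∈ densities) (hτ : τ ∈ densities) :
    nuclearAttraction ((1 / 2 : ℝ) • (ρ + τ) : L53)
      = (nuclearAttraction ρ + nuclearAttraction τ) / 2 := by
  rw [nuclearAttraction, nuclearAttraction, nuclearAttraction,
    ← integral_add (integrable_div_norm hρ.2) (integrable_div_norm hτ.2), ← integral_div]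
  refine integral_congr_ae ?_
  filter_upwards [ae_midpoint_eq_and_nonneg hρ.1 hτ.1] with x hx
  rw [hx.1]
  ring

theorem oneBodyDensity_ae_eq (γ Z : ℝ) {ρ : L53} (hρ : ρ ∈ densities) :
    oneBodyDensity γ Z ρ =ᵐ[volume]
      fun x => 3 / 5 * γ * |ρ x| ^ (5 / 3 : ℝ) - Z * (ρ x / ‖x‖) := by
  filter_upwards [hρ.1] with x hx
  rw [oneBodyDensity, abs_of_nonneg hx]
  ring

theorem integrable_oneBodyDensity (γ Z : ℝ) {ρ : L53} (hρ : ρ ∈ densities) :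
    Integrable (oneBodyDensity γ Z ρ) :=
  (((integrable_abs_rpow ρ).const_mul _).sub ((integrable_div_norm hρ.2).const_mul Z)).congr
    (oneBodyDensity_ae_eq γ Z hρ).symm

theorem energy_eq (γ Z : ℝ) {ρ : L53} (hρ : ρ ∈ densities) :
    energy γ Z ρ
      = 3 / 5 * γ * ‖ρ‖ ^ (5 / 3 : ℝ) - Z * nuclearAttraction ρ + coulombEnergy ρ := by
  rw [energy, integral_congr_ae (oneBodyDensity_ae_eq γ Z hρ),
    integral_sub ((integrable_abs_rpow ρ).const_mul _) ((integrable_div_norm hρ.2).const_mul Z),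
    integral_const_mul, integral_const_mul, ← norm_rpow_eq_integral, nuclearAttraction]

/-- The energy is convex, with a midpoint defect at least that of its `5/3` power term. -/
theorem energy_midpoint_le (γ Z : ℝ) {ρ τ : L53} (hρ : ρ ∈ densities) (hτ : τ ∈ densities) :
    energy γ Z ((1 / 2 : ℝ) • (ρ + τ) : L53) + 3 / 5 * γ * (‖ρ‖ ^ (5 / 3 : ℝ) / 2
        + ‖τ‖ ^ (5 / 3 : ℝ) / 2 - ‖(1 / 2 : ℝ) • (ρ + τ)‖ ^ (5 / 3 : ℝ))
      ≤ (energy γ Z ρ + energy γ Z τ) / 2 := by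
  rw [energy_eq γ Z hρ, energy_eq γ Z hτ, energy_eq γ Z (midpoint_mem_densities hρ hτ),
    nuclearAttraction_midpoint hρ hτ]
  have := coulombEnergy_midpoint_le hρ hτ
  linarith

/-! ### Passage to the limit -/

/-- Fatou's lemma for nonnegative integrable functions with bounded integrals. -/
theorem integrable_and_integral_le_of_tendsto_ae {α : Type*} [MeasurableSpace α] {μ : Measure α}
    {F : ℕ → α → ℝ} {f : α → ℝ} {K : ℝ} (hF : ∀ n, Integrable (F n) μ)
    (h0 : ∀ n, ∀ᵐ x ∂μ, 0 ≤ F n x) (hK : ∀ n, ∫ x, F n x ∂μ ≤ K)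
    (hlim : ∀ᵐ x ∂μ, Filter.Tendsto (fun n => F n x) Filter.atTop (nhds (f x))) :
    Integrable f μ ∧ ∫ x, f x ∂μ ≤ K := by
  have hf0 : ∀ᵐ x ∂μ, 0 ≤ f x := by
    filter_upwards [hlim, ae_all_iff.2 h0] with x hx hx0
    exact ge_of_tendsto' hx hx0
  have hK0 : 0 ≤ K := (integral_nonneg_of_ae (h0 0)).trans (hK 0)
  have hle : ∫⁻ x, ENNReal.ofReal (f x) ∂μ ≤ ENNReal.ofReal K := by
    calc ∫⁻ x, ENNReal.ofReal (f x) ∂μ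
        = ∫⁻ x, Filter.liminf (fun n => ENNReal.ofReal (F n x)) Filter.atTop ∂μ := by
          refine lintegral_congr_ae ?_
          filter_upwards [hlim] with x hx
          exact ((ENNReal.continuous_ofReal.tendsto _).comp hx).liminf_eq.symm
      _ ≤ Filter.liminf (fun n => ∫⁻ x, ENNReal.ofReal (F n x) ∂μ) Filter.atTop :=
          lintegral_liminf_le' fun n => (hF n).1.aemeasurable.ennreal_ofReal
      _ ≤ ENNReal.ofReal K := by
          refine Filter.liminf_le_of_frequently_le' (Filter.Frequently.of_forall fun n => ?_)
          rw [← ofReal_integral_eq_lintegral_ofReal (hF n) (h0 n)]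
          exact ENNReal.ofReal_le_ofReal (hK n)
  have hfm : AEStronglyMeasurable f μ :=
    aestronglyMeasurable_of_tendsto_ae _ (fun n => (hF n).1) hlim
  refine ⟨⟨hfm, ?_⟩, ?_⟩
  · rw [hasFiniteIntegral_iff_ofReal hf0]
    exact hle.trans_lt ENNReal.ofReal_lt_top
  · rw [integral_eq_lintegral_of_nonneg_ae hf0 hfm]
    exact ENNReal.toReal_le_of_le_ofReal hK0 hle

theorem exists_subseq_tendsto_ae {u : ℕ → L53} {ρ : L53}
    (hu : Filter.Tendsto u Filter.atTop (nhds ρ)) :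
    ∃ φ : ℕ → ℕ, ∀ᵐ x : R3, Filter.Tendsto (fun n => u (φ n) x) Filter.atTop (nhds (ρ x)) := by
  obtain ⟨φ, -, h⟩ := (tendstoInMeasure_of_tendsto_Lp hu).exists_seq_tendsto_ae
  exact ⟨φ, h⟩

/-- Bounded sublevel sets of the Coulomb energy are closed in `L^(5/3)`. -/
theorem mem_densities_and_coulombEnergy_le_of_tendsto {u : ℕ → L53} {ρ : L53} {K : ℝ}
    (hu : Filter.Tendsto u Filter.atTop (nhds ρ)) (hmem : ∀ n, u n ∈ densities)
    (hK : ∀ n, coulombEnergy (u n) ≤ K) : ρ ∈ densities ∧ coulombEnergy ρ ≤ K := by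
  obtain ⟨φ, hφ⟩ := exists_subseq_tendsto_ae hu
  have hpair : ∀ᵐ p : R3 × R3, Filter.Tendsto (fun n => coulombIntegrand (u (φ n)) p)
      Filter.atTop (nhds (coulombIntegrand ρ p)) := by
    rw [Measure.volume_eq_prod]
    filter_upwards [Measure.quasiMeasurePreserving_fst.ae hφ,
      Measure.quasiMeasurePreserving_snd.ae hφ] with p h1 h2
    exact (h1.mul h2).div_const _
  have h := integrable_and_integral_le_of_tendsto_ae (K := 2 * K) (fun n => (hmem (φ n)).2)
    (fun n => ae_nonneg_coulombIntegrand (hmem (φ n)).1)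
    (fun n => by have := hK (φ n); rw [coulombEnergy] at this; linarith) hpair
  refine ⟨⟨?_, h.1⟩, by rw [coulombEnergy]; linarith [h.2]⟩
  filter_upwards [hφ, ae_all_iff.2 fun n => (hmem (φ n)).1] with x hx hx0
  exact ge_of_tendsto' hx hx0

/-- The bound on the total mass is preserved by limits in `L^(5/3)`. -/
theorem integrable_and_integral_le_of_tendsto {u : ℕ → L53} {ρ : L53} {N : ℝ}
    (hu : Filter.Tendsto u Filter.atTop (nhds ρ)) (hmem : ∀ n, u n ∈ densitiesLE N) :
    Integrable (ρ : R3 → ℝ) ∧ ∫ x : R3, ρ x ≤ N := by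
  obtain ⟨φ, hφ⟩ := exists_subseq_tendsto_ae hu
  exact integrable_and_integral_le_of_tendsto_ae (fun n => (hmem (φ n)).2.1)
    (fun n => (hmem (φ n)).1.1) (fun n => (hmem (φ n)).2.2) hφ

theorem zero_mem_densitiesLE {N : ℝ} (hN : 0 ≤ N) : (0 : L53) ∈ densitiesLE N := by
  have h0 := Lp.coeFn_zero ℝ (5 / 3 : ℝ≥0∞) (volume : Measure R3)
  refine ⟨⟨h0.mono fun x hx => hx.ge, ?_⟩, ?_, ?_⟩
  · rw [integrable_coulombIntegrand_iff]
    simp [coulombLIntegral]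
  · exact (integrable_zero _ _ _).congr h0.symm
  · rw [integral_congr_ae h0]
    simpa using hN

theorem midpoint_mem_densitiesLE {N : ℝ} {ρ τ : L53} (hρ : ρ ∈ densitiesLE N)
    (hτ : τ ∈ densitiesLE N) : (1 / 2 : ℝ) • (ρ + τ) ∈ densitiesLE N := by
  have he : (((1 / 2 : ℝ) • (ρ + τ) : L53) : R3 → ℝ) =ᵐ[volume] fun x => (ρ x + τ x) / 2 :=
    (ae_midpoint_eq_and_nonneg hρ.1.1 hτ.1.1).mono fun x hx => hx.1
  refine ⟨midpoint_mem_densities hρ.1 hτ.1, ?_, ?_⟩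
  · exact ((hρ.2.1.add hτ.2.1).div_const 2).congr he.symm
  · rw [integral_congr_ae he, integral_div, integral_add hρ.2.1 hτ.2.1]
    linarith [hρ.2.2, hτ.2.2]

/-! ### Existence and uniqueness of minimizers -/

theorem exists_mul_le_mul_rpow_add {c : ℝ} (hc : 0 < c) {A : ℝ} (hA : 0 ≤ A) :
    ∃ B : ℝ, ∀ x : ℝ, 0 ≤ x → A * x ≤ c * x ^ (5 / 3 : ℝ) + B := by
  set t : ℝ := (A / c) ^ (3 / 2 : ℝ) with ht
  have ht0 : 0 ≤ t := by positivity
  refine ⟨A * t, fun x hx => ?_⟩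
  have hp : 0 ≤ c * x ^ (5 / 3 : ℝ) := by positivity
  rcases le_total x t with h | h
  · have := mul_le_mul_of_nonneg_left h hA
    linarith
  · have h1 : A / c ≤ x ^ (2 / 3 : ℝ) := by
      have : t ^ (2 / 3 : ℝ) = A / c := by
        rw [ht, ← Real.rpow_mul (by positivity)]; norm_num
      rw [← this]
      exact Real.rpow_le_rpow ht0 h (by norm_num)
    have h2 : x ^ (5 / 3 : ℝ) = x ^ (2 / 3 : ℝ) * x := by
      rw [show (5 / 3 : ℝ) = 2 / 3 + 1 by norm_num,
        Real.rpow_add_of_nonneg hx (by norm_num) (by norm_num), Real.rpow_one]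
    have h3 : A ≤ c * x ^ (2 / 3 : ℝ) := by rwa [div_le_iff₀' hc] at h1
    have h4 := mul_le_mul_of_nonneg_right h3 hx
    have h5 := mul_nonneg hA ht0
    rw [h2]
    linarith

/-- Coercivity: the energy controls both the `L^(5/3)` norm and the Coulomb energy. -/
theorem exists_le_energy_add {γ Z : ℝ} (hγ : 0 < γ) (hZ : 0 ≤ Z) :
    ∃ C : ℝ, ∀ ρ ∈ densities,
      3 / 10 * γ * ‖ρ‖ ^ (5 / 3 : ℝ) + coulombEnergy ρ / 2 ≤ energy γ Z ρ + C := by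
  -- For this `ε` the attraction outside the unit ball costs at most half of the Coulomb energy.
  set ε : ℝ := 1 / (8 * (Z + 1)) with hε
  have hε0 : 0 < ε := by positivity
  obtain ⟨A, hA, h⟩ := exists_nuclearAttraction_le hε0 one_pos
  obtain ⟨B, hB⟩ := exists_mul_le_mul_rpow_add (c := 3 / 10 * γ) (by positivity) (mul_nonneg hZ hA)
  have hzero : (0 : L53) ∈ densities := (zero_mem_densitiesLE le_rfl).1
  refine ⟨B + Z * (nuclearAttraction 0 + ε⁻¹ * 1⁻¹), fun ρ hρ => ?_⟩
  have h1 := mul_le_mul_of_nonneg_left (h ρ hρ 0 hzero) hZ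
  have h2 := hB ‖ρ‖ (norm_nonneg ρ)
  have h3 : Z * (4 * ε) ≤ 1 / 2 := by
    rw [hε, mul_one_div, mul_div_assoc', div_le_iff₀ (by positivity)]
    linarith
  have h4 := mul_le_mul_of_nonneg_right h3 (coulombEnergy_nonneg hρ)
  rw [sub_zero] at h1
  rw [energy_eq γ Z hρ]
  linarith

/-- Densities of almost minimal energy in a midpoint-convex set are close in `L^(5/3)`. -/
theorem exists_norm_sub_lt_of_energy_le {γ Z : ℝ} (hγ : 0 < γ) (hZ : 0 ≤ Z) {S : Set L53}
    (hS : S ⊆ densities) (hmid : ∀ ρ ∈ S, ∀ τ ∈ S, (1 / 2 : ℝ) • (ρ + τ) ∈ S) {I : ℝ}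
    (hI : ∀ ρ ∈ S, I ≤ energy γ Z ρ) {η : ℝ} (hη : 0 < η) :
    ∃ κ : ℝ, 0 < κ ∧ ∀ ρ ∈ S, ∀ τ ∈ S, energy γ Z ρ ≤ I + κ → energy γ Z τ ≤ I + κ →
      ‖ρ - τ‖ < η := by
  obtain ⟨C, hC⟩ := exists_le_energy_add hγ hZ
  set P : ℝ := |(I + 1 + C) / (3 / 10 * γ)| with hP
  have hP0 : 0 ≤ P := abs_nonneg _
  have hbound : ∀ ρ ∈ S, energy γ Z ρ ≤ I + 1 → ‖ρ‖ ^ (5 / 3 : ℝ) ≤ P := by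
    intro ρ hρ hE
    refine le_trans ?_ (le_abs_self _)
    rw [le_div_iff₀ (by positivity)]
    have h1 := hC ρ (hS hρ)
    have h2 := coulombEnergy_nonneg (hS hρ)
    linarith
  have hηp : 0 < η ^ (5 / 3 : ℝ) := by positivity
  set ε : ℝ := η ^ (5 / 3 : ℝ) / (4 * (P + 1)) with hε
  have hε0 : 0 < ε := by positivity
  have hεP : ε * (4 * (P + 1)) = η ^ (5 / 3 : ℝ) := by rw [hε]; field_simp
  obtain ⟨A, hA, h⟩ := exists_norm_sub_rpow_le (μ := (volume : Measure R3)) hε0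
  set A' : ℝ := A / (3 / 5 * γ) with hA'
  have hA'0 : 0 ≤ A' := by positivity
  set κ : ℝ := min 1 (η ^ (5 / 3 : ℝ) / (4 * (A' + 1))) with hκ
  have hκ0 : 0 < κ := by positivity
  refine ⟨κ, hκ0, fun ρ hρ τ hτ hEρ hEτ => ?_⟩
  have hκ1 : κ ≤ 1 := min_le_left _ _
  have hκA : κ * (4 * (A' + 1)) ≤ η ^ (5 / 3 : ℝ) := by
    rw [← le_div_iff₀ (by positivity)]
    exact min_le_right _ _
  have h1 := h ρ τ (hS hρ).1 (hS hτ).1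
  have h2 := energy_midpoint_le γ Z (hS hρ) (hS hτ)
  have h3 := hI _ (hmid ρ hρ τ hτ)
  have h4 := hbound ρ hρ (by linarith)
  have h5 := hbound τ hτ (by linarith)
  set G : ℝ := ‖ρ‖ ^ (5 / 3 : ℝ) / 2 + ‖τ‖ ^ (5 / 3 : ℝ) / 2
    - ‖(1 / 2 : ℝ) • (ρ + τ)‖ ^ (5 / 3 : ℝ) with hG
  have h6 : A * G ≤ A' * κ := by
    rw [hA', div_mul_eq_mul_div, le_div_iff₀ (by positivity)]
    have : 3 / 5 * γ * G ≤ κ := by linarith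
    have := mul_le_mul_of_nonneg_left this hA
    linarith
  have h7 : ε * (‖ρ‖ ^ (5 / 3 : ℝ) + ‖τ‖ ^ (5 / 3 : ℝ)) ≤ ε * (2 * P) :=
    mul_le_mul_of_nonneg_left (by linarith) hε0.le
  have h8 : ‖ρ - τ‖ ^ (5 / 3 : ℝ) < η ^ (5 / 3 : ℝ) := by nlinarith
  exact (Real.rpow_lt_rpow_iff (norm_nonneg _) hη.le (by norm_num)).1 h8

/-- The energy has exactly one minimizer on each nonempty midpoint-convex set of densities that is
closed in `L^(5/3)` relative to the set of all densities. -/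
theorem existsUnique_isMinimizer {γ Z : ℝ} (hγ : 0 < γ) (hZ : 0 ≤ Z) {S : Set L53}
    (hS : S ⊆ densities) (hne : S.Nonempty)
    (hmid : ∀ ρ ∈ S, ∀ τ ∈ S, (1 / 2 : ℝ) • (ρ + τ) ∈ S)
    (hclosed : ∀ (u : ℕ → L53) (ρ : L53), (∀ n, u n ∈ S) →
      Filter.Tendsto u Filter.atTop (nhds ρ) → ρ ∈ densities → ρ ∈ S) :
    ∃! ρ : L53, IsMinimizer (energy γ Z) S ρ := by
  obtain ⟨C, hC⟩ := exists_le_energy_add hγ hZ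
  have hbdd : BddBelow (energy γ Z '' S) := by
    refine ⟨-C, ?_⟩
    rintro _ ⟨ρ, hρ, rfl⟩
    have h1 := hC ρ (hS hρ)
    have h2 := coulombEnergy_nonneg (hS hρ)
    have h3 : 0 ≤ 3 / 10 * γ * ‖ρ‖ ^ (5 / 3 : ℝ) := by positivity
    linarith
  set I : ℝ := sInf (energy γ Z '' S) with hIdef
  have hI : ∀ ρ ∈ S, I ≤ energy γ Z ρ := fun ρ hρ => csInf_le hbdd ⟨ρ, hρ, rfl⟩
  have hseq : ∀ n : ℕ, ∃ ρ ∈ S, energy γ Z ρ < I + 1 / ((n : ℝ) + 1) := by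
    intro n
    obtain ⟨_, ⟨ρ, hρ, rfl⟩, h⟩ := exists_lt_of_csInf_lt (hne.image (energy γ Z))
      (show sInf (energy γ Z '' S) < I + 1 / ((n : ℝ) + 1) from
        lt_add_of_pos_right _ Nat.one_div_pos_of_nat)
    exact ⟨ρ, hρ, h⟩
  choose u huS huE using hseq
  have hcauchy : CauchySeq u := by
    refine Metric.cauchySeq_iff.2 fun η hη => ?_
    obtain ⟨κ, hκ, h⟩ := exists_norm_sub_lt_of_energy_le hγ hZ hS hmid hI hη
    obtain ⟨M, hM⟩ := exists_nat_one_div_lt hκ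
    have hle : ∀ n ≥ M, energy γ Z (u n) ≤ I + κ := fun n hn => by
      have := huE n
      have := Nat.one_div_le_one_div (α := ℝ) hn
      linarith
    refine ⟨M, fun m hm n hn => ?_⟩
    rw [dist_eq_norm]
    exact h _ (huS m) _ (huS n) (hle m hm) (hle n hn)
  obtain ⟨ρ, hρ⟩ := cauchySeq_tendsto_of_complete hcauchy
  set K : ℝ := 2 * (I + 1 + C) with hK
  have huK : ∀ n, coulombEnergy (u n) ≤ K := by
    intro n
    have h1 := hC _ (hS (huS n))
    have h2 : 0 ≤ 3 / 10 * γ * ‖u n‖ ^ (5 / 3 : ℝ) := by positivity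
    have h3 := huE n
    have h4 : 1 / ((n : ℝ) + 1) ≤ 1 := by
      rw [div_le_one (by positivity)]
      linarith [(Nat.cast_nonneg n : (0 : ℝ) ≤ n)]
    linarith
  have hK0 : 0 ≤ K := (coulombEnergy_nonneg (hS (huS 0))).trans (huK 0)
  have hρd := (mem_densities_and_coulombEnergy_le_of_tendsto hρ (fun n => hS (huS n)) huK).1
  have hρS := hclosed u ρ huS hρ hρd
  have hρI : energy γ Z ρ ≤ I := by
    refine le_of_forall_pos_le_add fun η hη => ?_
    -- Cut off the attraction so far out that its tail is at most `η / 2` along the sequence.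
    set ε : ℝ := η / (16 * (Z + 1) * (K + 1)) with hε
    have hε0 : 0 < ε := by positivity
    set R : ℝ := 4 * (Z + 1) / (ε * η) with hR
    have hR0 : 0 < R := by positivity
    obtain ⟨A, hA, hatt⟩ := exists_nuclearAttraction_le hε0 hR0
    have htail : ∀ n, Z * (4 * ε * coulombEnergy (u n) + ε⁻¹ * R⁻¹) ≤ η / 2 := by
      intro n
      have h1 : Z * (ε⁻¹ * R⁻¹) ≤ η / 4 := by
        have : (Z + 1) * (ε⁻¹ * R⁻¹) = η / 4 := by rw [hR]; field_simp
        have h0 : 0 ≤ ε⁻¹ * R⁻¹ := by positivity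
        linarith
      have h2 : Z * (4 * ε * coulombEnergy (u n)) ≤ η / 4 := by
        have h3 : (Z + 1) * (4 * ε * (K + 1)) = η / 4 := by rw [hε]; field_simp; norm_num
        rw [← h3]
        have := coulombEnergy_nonneg (hS (huS n))
        have := huK n
        gcongr <;> linarith
      linarith
    have hlim : Filter.Tendsto (fun n : ℕ => I + 1 / ((n : ℝ) + 1)
        - 3 / 5 * γ * ‖u n‖ ^ (5 / 3 : ℝ) + Z * (nuclearAttraction ρ + A * ‖u n - ρ‖) + η / 2)
        Filter.atTop (nhds (I + 0 - 3 / 5 * γ * ‖ρ‖ ^ (5 / 3 : ℝ)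
          + Z * (nuclearAttraction ρ + A * 0) + η / 2)) := by
      have hn : Filter.Tendsto (fun n => ‖u n‖ ^ (5 / 3 : ℝ)) Filter.atTop
          (nhds (‖ρ‖ ^ (5 / 3 : ℝ))) := hρ.norm.rpow_const (.inr (by norm_num))
      have hd : Filter.Tendsto (fun n => ‖u n - ρ‖) Filter.atTop (nhds 0) :=
        tendsto_iff_norm_sub_tendsto_zero.1 hρ
      exact (((tendsto_one_div_add_atTop_nhds_zero_nat.const_add I).sub (hn.const_mul _)).add
        (((hd.const_mul A).const_add _).const_mul Z)).add_const _
    obtain ⟨M, hM⟩ := Filter.eventually_atTop.1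
      (hlim.eventually_le_const (lt_add_of_pos_right _ (half_pos hη)))
    have hshift : Filter.Tendsto (fun n => u (n + M)) Filter.atTop (nhds ρ) :=
      hρ.comp (Filter.tendsto_add_atTop_nat M)
    have hD := (mem_densities_and_coulombEnergy_le_of_tendsto hshift
      (fun n => hS (huS (n + M))) (fun n => by
        refine le_trans ?_ (hM (n + M) (Nat.le_add_left M n))
        have h1 := huE (n + M)
        rw [energy_eq γ Z (hS (huS (n + M)))] at h1
        have h2 := mul_le_mul_of_nonneg_left (hatt _ (hS (huS (n + M))) ρ hρd) hZ
        have h3 := htail (n + M)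
        linarith)).2
    rw [energy_eq γ Z hρd]
    linarith
  have hmin : IsMinimizer (energy γ Z) S ρ := ⟨hρS, fun τ hτ => hρI.trans (hI τ hτ)⟩
  refine ⟨ρ, hmin, fun τ hτ => ?_⟩
  by_contra hne'
  obtain ⟨κ, hκ, h⟩ := exists_norm_sub_lt_of_energy_le hγ hZ hS hmid hI
    (norm_pos_iff.2 (sub_ne_zero.2 hne'))
  have h1 := hτ.2 ρ hρS
  exact lt_irrefl _ (h τ hτ.1 ρ hρS (by linarith) (by linarith))

end ThomasFermi

theorem mainTheorem2 (γ Z : ℝ) (hγ : 0 < γ) (hZ : 0 ≤ Z) :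
    (∀ ρ ∈ ThomasFermi.densities,
        MeasureTheory.Integrable (ThomasFermi.oneBodyDensity γ Z ρ)) ∧
      (∃! ρ : ThomasFermi.L53,
        ThomasFermi.IsMinimizer (ThomasFermi.energy γ Z) ThomasFermi.densities ρ) ∧
      ∀ N : ℝ, 0 ≤ N →
        ∃! ρ : ThomasFermi.L53,
          ThomasFermi.IsMinimizer (ThomasFermi.energy γ Z) (ThomasFermi.densitiesLE N) ρ := by
  refine ⟨fun ρ hρ => ThomasFermi.integrable_oneBodyDensity γ Z hρ, ?_, fun N hN => ?_⟩
  · exact ThomasFermi.existsUnique_isMinimizer hγ hZ subset_rfl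
      ⟨0, (ThomasFermi.zero_mem_densitiesLE le_rfl).1⟩
      (fun ρ hρ τ hτ => ThomasFermi.midpoint_mem_densities hρ hτ) (fun _ _ _ _ h => h)
  · exact ThomasFermi.existsUnique_isMinimizer hγ hZ (fun ρ hρ => hρ.1)
      ⟨0, ThomasFermi.zero_mem_densitiesLE hN⟩
      (fun ρ hρ τ hτ => ThomasFermi.midpoint_mem_densitiesLE hρ hτ)
      (fun u ρ hu hlim hρ =>
        ⟨hρ, ThomasFermi.integrable_and_integral_le_of_tendsto hlim hu⟩)
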